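/- **Theorem (pre-Grüss inequality).** Let $A$ be a bounded positive operator on a complex Hilbert space $\mathscr H$ with spectral resolution $(E_t)_{t\ge 0}$, and let $f,g:[0,\infty)\to\mathbb R$ be (Borel) measurable. For a measurable $h:[0,\infty)\to\mathbb R$ let $h(A)=\int_0^\infty h(t)\,dE_t$ be the (possibly unbounded) operator with domain $\{x\in\mathscr H:\int_0^\infty |h(t)|^2\,d\langle E_tx,x\rangle<\infty\}$; this is all of $\mathscr H$ when $h$ is bounded on the spectrum of $A$. Products of operators are taken on their natural domains. The Čebyšev functional is $$\mathcal C(f,g;A;x)=\langle f(A)g(A)x,x\rangle-\langle f(A)x,x\rangle\,\langle g(A)x,x\rangle .$$ Let $x\in\mathscr H$ with $\|x\|=1$ be such that $\mathcal C(f,f;A;x)$ and $\mathcal C(g,g;A;x)$ are defined, i.e. $x$ lies in the domains of $f(A)f(A)$ and of $g(A)g(A)$. Then $x$ also lies in the domains of $f(A)g(A)$, $f^2(A)$ and $g^2(A)$, the numbers $\mathcal C(f,f;A;x)=\langle f^2(A)x,x\rangle-\langle f(A)x,x\rangle^2$ and $\mathcal C(g,g;A;x)=\langle g^2(A)x,x\rangle-\langle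 g(A)x,x\rangle^2$ are real and nonnegative, and $$\left|\mathcal C(f,g;A;x)\right|\le \mathcal C(f,f;A;x)^{1/2}\;\mathcal C(g,g;A;x)^{1/2}.$$ In other words, $$\left|\langle f(A)g(A)x,x\rangle-\langle f(A)x,x\rangle\langle g(A)x,x\rangle\right|\le\left(\langle f^2(A)x,x\rangle-\langle f(A)x,x\rangle^2\right)^{1/2}\left(\langle g^2(A)x,x\rangle-\langle g(A)x,x\rangle^2\right)^{1/2}.$$ -/

import Mathlib

open MeasureTheory Filter Topology
open scoped NNReal ENNReal CompactlySupported InnerProductSpace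

noncomputable section

namespace PreGruss

variable {H : Type*} [NormedAddCommGroup H] [InnerProductSpace ℂ H] [CompleteSpace H]

/-- The bounded operator `φ(A)` for a continuous compactly supported `φ : [0, ∞) → ℝ`, given by
the continuous functional calculus. It is meant for positive `A`, whose spectrum lies
in `[0, ∞)`; there `t.toNNReal` is `t`. -/
def contCalc (A : H →L[ℂ] H) (φ : C_c(ℝ≥0, ℝ)) : H →L[ℂ] H :=
  cfc (fun t : ℝ => φ t.toNNReal) A

lemma continuous_comp_toNNReal (φ : C_c(ℝ≥0, ℝ)) :
    Continuous (fun t : ℝ => φ t.toNNReal) :=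
  φ.continuous.comp continuous_real_toNNReal

lemma contCalc_add (A : H →L[ℂ] H) (φ ψ : C_c(ℝ≥0, ℝ)) :
    contCalc A (φ + ψ) = contCalc A φ + contCalc A ψ :=
  cfc_add A (fun t : ℝ => φ t.toNNReal) (fun t : ℝ => ψ t.toNNReal)
    (continuous_comp_toNNReal φ).continuousOn (continuous_comp_toNNReal ψ).continuousOn

lemma contCalc_sub (A : H →L[ℂ] H) (φ ψ : C_c(ℝ≥0, ℝ)) :
    contCalc A (φ - ψ) = contCalc A φ - contCalc A ψ :=
  cfc_sub (fun t : ℝ => φ t.toNNReal) (fun t : ℝ => ψ t.toNNReal) A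
    (continuous_comp_toNNReal φ).continuousOn (continuous_comp_toNNReal ψ).continuousOn

lemma contCalc_mul (A : H →L[ℂ] H) (φ ψ : C_c(ℝ≥0, ℝ)) :
    contCalc A (φ * ψ) = contCalc A φ * contCalc A ψ :=
  cfc_mul (fun t : ℝ => φ t.toNNReal) (fun t : ℝ => ψ t.toNNReal) A
    (continuous_comp_toNNReal φ).continuousOn (continuous_comp_toNNReal ψ).continuousOn

lemma contCalc_smul (A : H →L[ℂ] H) (r : ℝ) (φ : C_c(ℝ≥0, ℝ)) :
    contCalc A (r • φ) = r • contCalc A φ :=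
  cfc_smul r (fun t : ℝ => φ t.toNNReal) A (continuous_comp_toNNReal φ).continuousOn

lemma contCalc_nonneg (A : H →L[ℂ] H) {φ : C_c(ℝ≥0, ℝ)} (hφ : 0 ≤ φ) : 0 ≤ contCalc A φ :=
  cfc_nonneg fun t _ => hφ t.toNNReal

lemma contCalc_selfAdjoint (A : H →L[ℂ] H) (φ : C_c(ℝ≥0, ℝ)) : IsSelfAdjoint (contCalc A φ) :=
  cfc_predicate (R := ℝ) _ A

/-- The positive linear functional `φ ↦ ⟨φ(A)x, x⟩`. -/
def spectralFunctional (A : H →L[ℂ] H) (x : H) : C_c(ℝ≥0, ℝ) →ₚ[ℝ] ℝ :=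
  PositiveLinearMap.mk₀
    { toFun := fun φ => (⟪x, contCalc A φ x⟫_ℂ).re
      map_add' := fun φ ψ => by simp [contCalc_add]
      map_smul' := fun r φ => by
        rw [contCalc_smul, _root_.smul_apply, ← Complex.coe_smul r (contCalc A φ x),
          inner_smul_right, Complex.re_ofReal_mul]
        rfl }
    (fun φ hφ => by
      have h := (ContinuousLinearMap.nonneg_iff_isPositive _).1 (contCalc_nonneg A hφ)
      exact h.re_inner_nonneg_right x)

/-- The spectral measure `d⟨E_t x, x⟩` of `A` at `x`: the Borel measure on `[0, ∞)` with
`∫ φ(t) d⟨E_t x, x⟩ = ⟨φ(A)x, x⟩` for all continuous compactly supported `φ`. -/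
def spectralMeasure (A : H →L[ℂ] H) (x : H) : Measure ℝ≥0 :=
  RealRMK.rieszMeasure (spectralFunctional A x)

instance (A : H →L[ℂ] H) (x : H) : (spectralMeasure A x).Regular :=
  RealRMK.regular_rieszMeasure (spectralFunctional A x)

lemma integral_spectralMeasure (A : H →L[ℂ] H) (x : H) (φ : C_c(ℝ≥0, ℝ)) :
    ∫ t, φ t ∂(spectralMeasure A x) = (⟪x, contCalc A φ x⟫_ℂ).re :=
  RealRMK.integral_rieszMeasure (spectralFunctional A x) φ

lemma memLp_cc (φ : C_c(ℝ≥0, ℝ)) (μ : Measure ℝ≥0) [IsFiniteMeasureOnCompacts μ] :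
    MemLp φ 2 μ :=
  φ.continuous.memLp_of_hasCompactSupport φ.hasCompactSupport

/-- `φ ↦ φ(A)x` is isometric for the `L²(d⟨E_t x, x⟩)` norm. -/
lemma enorm_contCalc (A : H →L[ℂ] H) (x : H) (φ : C_c(ℝ≥0, ℝ)) :
    ‖contCalc A φ x‖ₑ = eLpNorm φ 2 (spectralMeasure A x) := by
  have h1 : ∫ t, ‖φ t‖ ^ 2 ∂(spectralMeasure A x) = ‖contCalc A φ x‖ ^ 2 := by
    have h := integral_spectralMeasure A x (φ * φ)
    rw [contCalc_mul] at h
    have h2 : ⟪x, (contCalc A φ * contCalc A φ) x⟫_ℂ = ⟪contCalc A φ x, contCalc A φ x⟫_ℂ := by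
      have := ContinuousLinearMap.adjoint_inner_left (contCalc A φ) (contCalc A φ x) x
      rw [(contCalc_selfAdjoint A φ).adjoint_eq] at this
      rw [this]; rfl
    rw [h2] at h
    have h3 : (⟪contCalc A φ x, contCalc A φ x⟫_ℂ).re = ‖contCalc A φ x‖ ^ 2 :=
      inner_self_eq_norm_sq (𝕜 := ℂ) _
    rw [h3] at h
    rw [← h]
    congr 1
    ext t
    simp [sq]
  rw [MemLp.eLpNorm_eq_integral_rpow_norm two_ne_zero ENNReal.ofNat_ne_top (memLp_cc φ _)]
  simp only [ENNReal.toReal_ofNat, Real.rpow_ofNat, h1]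
  rw [← ofReal_norm]
  congr 1
  rw [← Real.rpow_natCast, ← Real.rpow_mul (norm_nonneg _)]
  norm_num

lemma spectralMeasure_smul (A : H →L[ℂ] H) (c : ℂ) (x : H) :
    spectralMeasure A (c • x) = (‖c‖₊ ^ 2) • spectralMeasure A x := by
  apply Measure.ext_of_integral_eq_on_compactlySupported
  intro φ
  rw [integral_smul_nnreal_measure, integral_spectralMeasure, integral_spectralMeasure, map_smul,
    inner_smul_left, inner_smul_right, ← mul_assoc, ← Complex.normSq_eq_conj_mul_self,
    Complex.re_ofReal_mul, Complex.normSq_eq_norm_sq, NNReal.smul_def]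
  simp

instance instLocallyFiniteAdd (μ ν : Measure ℝ≥0) [IsLocallyFiniteMeasure μ]
    [IsLocallyFiniteMeasure ν] : IsLocallyFiniteMeasure (μ + ν) := by
  refine ⟨fun t => ?_⟩
  obtain ⟨s, hs, hμ⟩ := μ.finiteAt_nhds t
  obtain ⟨r, hr, hν⟩ := ν.finiteAt_nhds t
  refine ⟨s ∩ r, inter_mem hs hr, ?_⟩
  rw [Measure.add_apply]
  exact ENNReal.add_lt_top.2 ⟨(measure_mono Set.inter_subset_left).trans_lt hμ,
    (measure_mono Set.inter_subset_right).trans_lt hν⟩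

lemma spectralMeasure_add_le (A : H →L[ℂ] H) (x y : H) :
    spectralMeasure A (x + y) ≤ (2 : ℝ≥0) • (spectralMeasure A x + spectralMeasure A y) := by
  have h : spectralMeasure A (x + y) + spectralMeasure A (x - y)
      = (2 : ℝ≥0) • (spectralMeasure A x + spectralMeasure A y) := by
    apply Measure.ext_of_integral_eq_on_compactlySupported
    intro φ
    have hi : ∀ z, Integrable φ (spectralMeasure A z) := fun z =>
      φ.continuous.integrable_of_hasCompactSupport φ.hasCompactSupport
    rw [integral_smul_nnreal_measure, integral_add_measure (hi _) (hi _),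
      integral_add_measure (hi _) (hi _)]
    simp only [integral_spectralMeasure, map_add, map_sub, inner_add_left, inner_add_right,
      inner_sub_left, inner_sub_right, Complex.add_re, Complex.sub_re, NNReal.smul_def, smul_eq_mul,
      NNReal.coe_ofNat]
    ring
  rw [← h]
  exact Measure.le_add_right le_rfl

/-- Convergence `φ → f` in `L²(μ)`, as a filter on the continuous compactly supported `φ`. -/
def approx (f : ℝ≥0 → ℝ) (μ : Measure ℝ≥0) : Filter C_c(ℝ≥0, ℝ) :=
  comap (fun φ : C_c(ℝ≥0, ℝ) => eLpNorm (f - ⇑φ) 2 μ) (𝓝 0)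

lemma approx_neBot {f : ℝ≥0 → ℝ} {μ : Measure ℝ≥0} [μ.Regular] (hf : MemLp f 2 μ) :
    (approx f μ).NeBot := by
  rw [approx, comap_neBot_iff]
  intro s hs
  obtain ⟨ε, hε, hs⟩ := ENNReal.nhds_zero_basis_Iic.mem_iff.1 hs
  obtain ⟨g, hg, hle, hc, -⟩ :=
    hf.exists_hasCompactSupport_eLpNorm_sub_le ENNReal.ofNat_ne_top hε.ne'
  exact ⟨⟨⟨g, hc⟩, hg⟩, hs hle⟩

lemma approx_le {f : ℝ≥0 → ℝ} {μ ν : Measure ℝ≥0} (c : ℝ≥0) (h : ν ≤ c • μ) :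
    approx f μ ≤ approx f ν := by
  have key : Tendsto (fun φ : C_c(ℝ≥0, ℝ) => eLpNorm (f - ⇑φ) 2 ν) (approx f μ) (𝓝 0) := by
    have h0 : Tendsto (fun φ : C_c(ℝ≥0, ℝ) => eLpNorm (f - ⇑φ) 2 μ) (approx f μ) (𝓝 0) :=
      tendsto_comap
    have h1 := ENNReal.Tendsto.const_mul (a := (c : ℝ≥0∞) ^ (1 / (2 : ℝ≥0∞)).toReal) h0
      (Or.inr (ENNReal.rpow_ne_top_of_nonneg ENNReal.toReal_nonneg ENNReal.coe_ne_top))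
    rw [mul_zero] at h1
    refine tendsto_of_tendsto_of_tendsto_of_le_of_le tendsto_const_nhds h1
      (fun _ => bot_le) fun φ => ?_
    calc eLpNorm (f - ⇑φ) 2 ν ≤ eLpNorm (f - ⇑φ) 2 ((c : ℝ≥0∞) • μ) := eLpNorm_mono_measure _ h
      _ = _ := by rw [eLpNorm_smul_measure_of_ne_top ENNReal.ofNat_ne_top, smul_eq_mul]
  exact tendsto_iff_comap.1 key

/-- The vector `f(A)x = ∫ f(t) dE_t x`, for `f ∈ L²(d⟨E_t x, x⟩)`: the limit of `φ(A)x` as the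
continuous compactly supported `φ` tends to `f` in `L²(d⟨E_t x, x⟩)`. -/
def borelApply (A : H →L[ℂ] H) (f : ℝ≥0 → ℝ) (x : H) : H :=
  haveI : Nonempty H := ⟨0⟩
  limUnder (approx f (spectralMeasure A x)) (fun φ => contCalc A φ x)

lemma tendsto_borelApply {A : H →L[ℂ] H} {f : ℝ≥0 → ℝ} {x : H}
    (hf : MemLp f 2 (spectralMeasure A x)) :
    Tendsto (fun φ => contCalc A φ x) (approx f (spectralMeasure A x))
      (𝓝 (borelApply A f x)) := by
  have := approx_neBot hf
  have hc : Cauchy (map (fun φ => contCalc A φ x) (approx f (spectralMeasure A x))) := by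
    refine EMetric.cauchy_iff.2 ⟨(Filter.map_neBot (hf := this)).ne, fun ε hε => ?_⟩
    refine ⟨_, image_mem_map (preimage_mem_comap (m := fun φ : C_c(ℝ≥0, ℝ) =>
      eLpNorm (f - ⇑φ) 2 (spectralMeasure A x)) (Iio_mem_nhds (ENNReal.half_pos hε.ne'))), ?_⟩
    rintro _ ⟨φ, hφ, rfl⟩ _ ⟨ψ, hψ, rfl⟩
    simp only [Set.mem_preimage, Set.mem_Iio] at hφ hψ
    rw [edist_eq_enorm_sub]
    have h1 : contCalc A φ x - contCalc A ψ x = contCalc A (φ - ψ) x := by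
      rw [contCalc_sub]; rfl
    have h2 : (⇑(φ - ψ) : ℝ≥0 → ℝ) = (f - ⇑ψ) - (f - ⇑φ) := by
      ext t; simp
    rw [h1, enorm_contCalc, h2]
    have ha := (hf.sub (memLp_cc φ (spectralMeasure A x))).aestronglyMeasurable
    have hb := (hf.sub (memLp_cc ψ (spectralMeasure A x))).aestronglyMeasurable
    calc _ ≤ _ := eLpNorm_sub_le hb ha (by norm_num)
      _ < ε / 2 + ε / 2 := ENNReal.add_lt_add hψ hφ
      _ = ε := ENNReal.add_halves ε
  obtain ⟨z, hz⟩ := CompleteSpace.complete hc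
  exact tendsto_nhds_limUnder ⟨z, hz⟩

lemma memLp_add {A : H →L[ℂ] H} {f : ℝ≥0 → ℝ} {x y : H}
    (hx : MemLp f 2 (spectralMeasure A x)) (hy : MemLp f 2 (spectralMeasure A y)) :
    MemLp f 2 (spectralMeasure A x + spectralMeasure A y) := by
  refine ⟨hx.1.add_measure hy.1, ?_⟩
  rw [eLpNorm_lt_top_iff_lintegral_rpow_enorm_lt_top two_ne_zero ENNReal.ofNat_ne_top,
    lintegral_add_measure]
  exact ENNReal.add_lt_top.2
    ⟨(eLpNorm_lt_top_iff_lintegral_rpow_enorm_lt_top two_ne_zero ENNReal.ofNat_ne_top).1 hx.2,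
      (eLpNorm_lt_top_iff_lintegral_rpow_enorm_lt_top two_ne_zero ENNReal.ofNat_ne_top).1 hy.2⟩

/-- The operator `f(A) = ∫ f(t) dE_t` of the Borel functional calculus, for a real function `f`
on `[0, ∞)`, bounded or not: its domain is `{x | ∫ |f(t)|² d⟨E_t x, x⟩ < ∞}`, which is all
of `H` when `f` is measurable and bounded on the spectrum of `A`. -/
def borelCalc (A : H →L[ℂ] H) (f : ℝ≥0 → ℝ) : H →ₗ.[ℂ] H where
  domain :=
    { carrier := {x | MemLp f 2 (spectralMeasure A x)}
      zero_mem' := by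
        have h : spectralMeasure A (0 : H) = 0 := by
          simpa using spectralMeasure_smul A 0 (0 : H)
        simp [h]
      add_mem' := fun {x y} hx hy =>
        ((memLp_add hx hy).smul_measure (c := ((2 : ℝ≥0) : ℝ≥0∞)) ENNReal.coe_ne_top).mono_measure
          (spectralMeasure_add_le A x y)
      smul_mem' := fun c x hx => by
        have h := MemLp.smul_measure (c := ((‖c‖₊ ^ 2 : ℝ≥0) : ℝ≥0∞)) hx ENNReal.coe_ne_top
        change MemLp f 2 (spectralMeasure A (c • x))
        rw [spectralMeasure_smul]
        exact h }
  toFun :=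
    { toFun := fun x => borelApply A f x
      map_add' := by
        rintro ⟨x, hx⟩ ⟨y, hy⟩
        change borelApply A f (x + y) = borelApply A f x + borelApply A f y
        have hxy : MemLp f 2 (spectralMeasure A (x + y)) :=
          ((memLp_add hx hy).smul_measure (c := ((2 : ℝ≥0) : ℝ≥0∞))
            ENNReal.coe_ne_top).mono_measure (spectralMeasure_add_le A x y)
        have := approx_neBot (memLp_add hx hy)
        have h1 := (tendsto_borelApply hx).mono_left
          (approx_le (μ := spectralMeasure A x + spectralMeasure A y) 1
            (by rw [one_smul]; exact Measure.le_add_right le_rfl))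
        have h2 := (tendsto_borelApply hy).mono_left
          (approx_le (μ := spectralMeasure A x + spectralMeasure A y) 1
            (by rw [one_smul]; exact Measure.le_add_left le_rfl))
        have h3 := (tendsto_borelApply hxy).mono_left (approx_le 2 (spectralMeasure_add_le A x y))
        refine tendsto_nhds_unique h3 ((h1.add h2).congr fun φ => ?_)
        rw [map_add]
      map_smul' := by
        rintro c ⟨x, hx⟩
        change borelApply A f (c • x) = c • borelApply A f x
        have hcx : MemLp f 2 (spectralMeasure A (c • x)) := by
          rw [spectralMeasure_smul]
          exact MemLp.smul_measure (c := ((‖c‖₊ ^ 2 : ℝ≥0) : ℝ≥0∞)) hx ENNReal.coe_ne_top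
        have := approx_neBot hx
        have h3 := (tendsto_borelApply hcx).mono_left
          (approx_le (‖c‖₊ ^ 2) (spectralMeasure_smul A c x).le)
        refine tendsto_nhds_unique h3 (((tendsto_borelApply hx).const_smul c).congr fun φ => ?_)
        rw [map_smul] }

/-- The product `S T` of two operators with their natural domains:
`D(S T) = {x ∈ D(T) | T x ∈ D(S)}`. -/
def opMul (S T : H →ₗ.[ℂ] H) : H →ₗ.[ℂ] H where
  domain := (S.domain.comap T.toFun).map T.domain.subtype
  toFun :=
    { toFun := fun x => S ⟨T ⟨x, (Submodule.map_subtype_le _ _) x.2⟩, by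
        obtain ⟨y, hy, hyx⟩ := x.2
        have : y = ⟨x, (Submodule.map_subtype_le _ _) x.2⟩ := Subtype.ext hyx
        rw [← this]; exact hy⟩
      map_add' := fun x y => by
        rw [← S.map_add]
        exact congrArg S (Subtype.ext (T.map_add ⟨x, _⟩ ⟨y, _⟩))
      map_smul' := fun c x => by
        rw [RingHom.id_apply, ← S.map_smul]
        exact congrArg S (Subtype.ext (T.map_smul c ⟨x, _⟩)) }

/-- The Čebyšev functional
`C(f, g; A; x) = ⟨f(A)g(A)x, x⟩ - ⟨f(A)x, x⟩⟨g(A)x, x⟩`, for `x` in the domains of the operators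
that occur. Mathlib's inner product is linear in the second variable. -/
def cebysev (A : H →L[ℂ] H) (f g : ℝ≥0 → ℝ) (x : H)
    (hf : x ∈ (borelCalc A f).domain) (hg : x ∈ (borelCalc A g).domain)
    (hfg : x ∈ (opMul (borelCalc A f) (borelCalc A g)).domain) : ℂ :=
  ⟪x, opMul (borelCalc A f) (borelCalc A g) ⟨x, hfg⟩⟫_ℂ
    - ⟪x, borelCalc A f ⟨x, hf⟩⟫_ℂ * ⟪x, borelCalc A g ⟨x, hg⟩⟫_ℂ

end PreGruss

end

/-!
Write `μ` for the spectral measure of `A` at `x`. Every vector `f(A)x` is a limit of vectors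
`φ(A)x` with `φ` continuous and compactly supported, `φ → f` in `L²(μ)`; passing to the limit in
`⟨φ(A)x, ψ(A)x⟩ = ∫ φψ dμ` gives three facts.

* `f(A)` is a symmetric operator (`inner_borelApply_comm`).
* The spectral measure of `A` at `g(A)x` is `g² μ` (`spectralMeasure_borelApply`). Hence `x` lies in
  the domain of `f(A)g(A)` as soon as `x ∈ D(g(A))` and `fg ∈ L²(μ)`, and the hypotheses on
  `f(A)f(A)` and `g(A)g(A)` say that `f²` and `g²` are in `L²(μ)`. As `|fg| ≤ f² + g²`, all the
  domain assertions follow.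
* `⟨x, f²(A)x⟩ = ⟨f(A)x, f(A)x⟩` (`inner_borelApply_sq`).

By symmetry the Čebyšev functional is the inner product of the components of `f(A)x` and `g(A)x`
orthogonal to `x` (`cebysev_eq_inner`). So `C(f, f; A; x)` is a squared norm, and the
inequality is the Cauchy–Schwarz inequality in `H`.
-/

namespace PreGruss

variable {H : Type*} [NormedAddCommGroup H] [InnerProductSpace ℂ H] [CompleteSpace H]

/-! ### Limits in `L²` -/

/-- The integral of a product is continuous for `L²` convergence of both factors. -/
lemma tendsto_integral_mul {α ι : Type*} [MeasurableSpace α] {μ : Measure α} {l : Filter ι}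
    {u v : ι → α → ℝ} {f g : α → ℝ} (hu : ∀ i, MemLp (u i) 2 μ) (hv : ∀ i, MemLp (v i) 2 μ)
    (hf : MemLp f 2 μ) (hg : MemLp g 2 μ)
    (huf : Tendsto (fun i => eLpNorm (f - u i) 2 μ) l (𝓝 0))
    (hvg : Tendsto (fun i => eLpNorm (g - v i) 2 μ) l (𝓝 0)) :
    Tendsto (fun i => ∫ t, u i t * v i t ∂μ) l (𝓝 (∫ t, f t * g t ∂μ)) := by
  have h1 := (Lp.tendsto_Lp_iff_tendsto_eLpNorm'' u hu f hf).2
    (by simpa only [eLpNorm_sub_comm] using huf)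
  have h2 := (Lp.tendsto_Lp_iff_tendsto_eLpNorm'' v hv g hg).2
    (by simpa only [eLpNorm_sub_comm] using hvg)
  have key : ∀ {p q : α → ℝ} (hp : MemLp p 2 μ) (hq : MemLp q 2 μ),
      ⟪hp.toLp p, hq.toLp q⟫_ℝ = ∫ t, p t * q t ∂μ := fun hp hq => by
    rw [L2.inner_def]
    refine integral_congr_ae ?_
    filter_upwards [hp.coeFn_toLp, hq.coeFn_toLp] with t h h'
    simp [h, h', mul_comm]
  simpa only [key] using h1.inner (𝕜 := ℝ) h2

lemma tendsto_approx (f : ℝ≥0 → ℝ) (μ : Measure ℝ≥0) :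
    Tendsto (fun φ : C_c(ℝ≥0, ℝ) => eLpNorm (f - ⇑φ) 2 μ) (approx f μ) (𝓝 0) :=
  tendsto_comap

lemma exists_norm_le (φ : C_c(ℝ≥0, ℝ)) : ∃ C, ∀ t, ‖φ t‖ ≤ C :=
  φ.hasCompactSupport.exists_bound_of_continuous φ.continuous

lemma memLp_cc_mul {f : ℝ≥0 → ℝ} {μ : Measure ℝ≥0} (φ : C_c(ℝ≥0, ℝ)) (hf : MemLp f 2 μ) :
    MemLp (⇑φ * f) 2 μ := by
  obtain ⟨C, hC⟩ := exists_norm_le φ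
  refine hf.of_le_mul (c := C) (φ.continuous.aestronglyMeasurable.mul hf.1)
    (Eventually.of_forall fun t => ?_)
  rw [Pi.mul_apply, norm_mul]
  exact mul_le_mul_of_nonneg_right (hC t) (norm_nonneg _)

lemma tendsto_approx_mul (φ : C_c(ℝ≥0, ℝ)) (f : ℝ≥0 → ℝ) (μ : Measure ℝ≥0) :
    Tendsto (fun ψ : C_c(ℝ≥0, ℝ) => eLpNorm (⇑φ * f - ⇑φ * ⇑ψ) 2 μ) (approx f μ) (𝓝 0) := by
  obtain ⟨C, hC⟩ := exists_norm_le φ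
  have h := ENNReal.Tendsto.const_mul (a := ENNReal.ofReal C) (tendsto_approx f μ)
    (Or.inr ENNReal.ofReal_ne_top)
  rw [mul_zero] at h
  refine tendsto_of_tendsto_of_tendsto_of_le_of_le tendsto_const_nhds h (fun _ => bot_le)
    fun ψ => eLpNorm_le_mul_eLpNorm_of_ae_le_mul (Eventually.of_forall fun t => ?_) 2
  rw [← mul_sub, Pi.mul_apply, norm_mul]
  exact mul_le_mul_of_nonneg_right (hC t) (norm_nonneg _)

/-! ### The continuous calculus -/

lemma inner_contCalc_comm (A : H →L[ℂ] H) (φ : C_c(ℝ≥0, ℝ)) (x y : H) :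
    ⟪contCalc A φ x, y⟫_ℂ = ⟪x, contCalc A φ y⟫_ℂ := by
  have := ContinuousLinearMap.adjoint_inner_left (contCalc A φ) y x
  rwa [(contCalc_selfAdjoint A φ).adjoint_eq] at this

lemma inner_contCalc_self (A : H →L[ℂ] H) (x : H) (φ : C_c(ℝ≥0, ℝ)) :
    ⟪x, contCalc A φ x⟫_ℂ = ((∫ t, φ t ∂(spectralMeasure A x) : ℝ) : ℂ) := by
  rw [integral_spectralMeasure]
  refine (Complex.conj_eq_iff_re.1 ?_).symm
  rw [inner_conj_symm, inner_contCalc_comm]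

lemma inner_contCalc_contCalc (A : H →L[ℂ] H) (x : H) (φ ψ : C_c(ℝ≥0, ℝ)) :
    ⟪contCalc A φ x, contCalc A ψ x⟫_ℂ
      = ((∫ t, φ t * ψ t ∂(spectralMeasure A x) : ℝ) : ℂ) := by
  have h := inner_contCalc_self A x (φ * ψ)
  rw [contCalc_mul] at h
  rw [inner_contCalc_comm]
  exact h

/-- Some continuous compactly supported function is `1` on the spectrum of `A`. -/
lemma exists_contCalc_eq_one {A : H →L[ℂ] H} (hA : IsSelfAdjoint A) :
    ∃ φ : C_c(ℝ≥0, ℝ), contCalc A φ = 1 := by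
  obtain ⟨φ, hφ, -, hc, -⟩ := exists_continuous_one_zero_of_isCompact
    (isCompact_Icc (a := (0 : ℝ≥0)) (b := ‖A‖₊ * ‖(1 : H →L[ℂ] H)‖₊)) isClosed_empty
    (Set.disjoint_empty _)
  refine ⟨⟨φ, hc⟩, ?_⟩
  rw [contCalc, ← cfc_one ℝ A]
  refine cfc_congr fun t ht => hφ ⟨zero_le, ?_⟩
  rw [Real.toNNReal_le_iff_le_coe]
  exact (le_abs_self t).trans (by simpa using spectrum.norm_le_norm_mul_of_mem ht)

/-! ### The Borel calculus -/

lemma inner_contCalc_borelApply {A : H →L[ℂ] H} {x : H} {f : ℝ≥0 → ℝ}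
    (hf : MemLp f 2 (spectralMeasure A x)) (φ : C_c(ℝ≥0, ℝ)) :
    ⟪contCalc A φ x, borelApply A f x⟫_ℂ
      = ((∫ t, φ t * f t ∂(spectralMeasure A x) : ℝ) : ℂ) := by
  have := approx_neBot hf
  have h1 := (tendsto_const_nhds (x := contCalc A φ x)).inner (𝕜 := ℂ) (tendsto_borelApply hf)
  simp only [inner_contCalc_contCalc] at h1
  have h2 := tendsto_integral_mul (u := fun _ => φ) (v := fun ψ : C_c(ℝ≥0, ℝ) => ⇑ψ)
    (fun _ => memLp_cc φ _) (fun ψ => memLp_cc ψ _) (memLp_cc φ _) hf (by simp)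
    (tendsto_approx f (spectralMeasure A x))
  exact tendsto_nhds_unique h1 ((Complex.continuous_ofReal.tendsto _).comp h2)

lemma inner_borelApply_contCalc_borelApply {A : H →L[ℂ] H} {x : H} {f : ℝ≥0 → ℝ}
    (hf : MemLp f 2 (spectralMeasure A x)) (φ : C_c(ℝ≥0, ℝ)) :
    ⟪borelApply A f x, contCalc A φ (borelApply A f x)⟫_ℂ
      = ((∫ t, φ t * f t ^ 2 ∂(spectralMeasure A x) : ℝ) : ℂ) := by
  have := approx_neBot hf
  have h0 := tendsto_borelApply hf
  have h1 := h0.inner (𝕜 := ℂ) (((contCalc A φ).continuous.tendsto _).comp h0)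
  have h2 := tendsto_integral_mul (u := fun ψ : C_c(ℝ≥0, ℝ) => ⇑φ * ⇑ψ)
    (v := fun ψ : C_c(ℝ≥0, ℝ) => ⇑ψ)
    (fun ψ => memLp_cc_mul φ (memLp_cc ψ _)) (fun ψ => memLp_cc ψ _) (memLp_cc_mul φ hf) hf
    (tendsto_approx_mul φ f _) (tendsto_approx f (spectralMeasure A x))
  have h3 : ∀ ψ : C_c(ℝ≥0, ℝ), ⟪contCalc A ψ x, contCalc A φ (contCalc A ψ x)⟫_ℂ
      = ((∫ t, (⇑φ * ⇑ψ) t * ψ t ∂(spectralMeasure A x) : ℝ) : ℂ) := fun ψ => by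
    rw [← inner_contCalc_comm, ← mul_apply_eq_comp, ← contCalc_mul,
      inner_contCalc_contCalc]
    rfl
  simp only [Function.comp_def, h3] at h1
  rw [tendsto_nhds_unique h1 ((Complex.continuous_ofReal.tendsto _).comp h2)]
  congr 2
  ext t
  simp [sq, mul_assoc]

/-- The operator `f(A)` is symmetric. -/
lemma inner_borelApply_comm {A : H →L[ℂ] H} {f : ℝ≥0 → ℝ} {x y : H}
    (hx : MemLp f 2 (spectralMeasure A x)) (hy : MemLp f 2 (spectralMeasure A y)) :
    ⟪borelApply A f x, y⟫_ℂ = ⟪x, borelApply A f y⟫_ℂ := by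
  have := approx_neBot (memLp_add hx hy)
  have h1 := (tendsto_borelApply hx).mono_left
    (approx_le (μ := spectralMeasure A x + spectralMeasure A y) 1
      (by rw [one_smul]; exact Measure.le_add_right le_rfl))
  have h2 := (tendsto_borelApply hy).mono_left
    (approx_le (μ := spectralMeasure A x + spectralMeasure A y) 1
      (by rw [one_smul]; exact Measure.le_add_left le_rfl))
  refine tendsto_nhds_unique (h1.inner (𝕜 := ℂ) tendsto_const_nhds)
    ((tendsto_const_nhds.inner (𝕜 := ℂ) h2).congr fun φ => ?_)
  rw [inner_contCalc_comm]

/-- The spectral measure at `g(A)x` has density `g²` with respect to the spectral measure at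
`x`. -/
lemma spectralMeasure_borelApply {A : H →L[ℂ] H} {g : ℝ≥0 → ℝ} {x : H} (hgm : Measurable g)
    (hg : MemLp g 2 (spectralMeasure A x)) :
    spectralMeasure A (borelApply A g x)
      = (spectralMeasure A x).withDensity (fun t => ((‖g t‖₊ ^ 2 : ℝ≥0) : ℝ≥0∞)) := by
  have hfin : ∫⁻ t, ((‖g t‖₊ ^ 2 : ℝ≥0) : ℝ≥0∞) ∂(spectralMeasure A x) ≠ ∞ := by
    have h :=
      (eLpNorm_lt_top_iff_lintegral_rpow_enorm_lt_top two_ne_zero ENNReal.ofNat_ne_top).1 hg.2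
    simpa [enorm_eq_nnnorm] using h.ne
  have := isFiniteMeasure_withDensity hfin
  apply Measure.ext_of_integral_eq_on_compactlySupported
  intro φ
  rw [integral_withDensity_eq_integral_smul (by fun_prop), integral_spectralMeasure,
    inner_borelApply_contCalc_borelApply hg, Complex.ofReal_re]
  congr 1
  ext t
  simp [NNReal.smul_def, mul_comm]

lemma memLp_borelApply_iff {A : H →L[ℂ] H} {f g : ℝ≥0 → ℝ} {x : H} (hfm : Measurable f)
    (hgm : Measurable g) (hg : MemLp g 2 (spectralMeasure A x)) :
    MemLp f 2 (spectralMeasure A (borelApply A g x)) ↔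
      MemLp (fun t => f t * g t) 2 (spectralMeasure A x) := by
  have hfg : Measurable fun t => f t * g t := hfm.mul hgm
  rw [MemLp, MemLp, and_iff_right hfm.aestronglyMeasurable,
    and_iff_right hfg.aestronglyMeasurable,
    eLpNorm_lt_top_iff_lintegral_rpow_enorm_lt_top two_ne_zero ENNReal.ofNat_ne_top,
    eLpNorm_lt_top_iff_lintegral_rpow_enorm_lt_top two_ne_zero ENNReal.ofNat_ne_top,
    spectralMeasure_borelApply hgm hg,
    lintegral_withDensity_eq_lintegral_mul _ (by fun_prop) (by fun_prop)]
  refine iff_of_eq (congrArg (· < ∞) (lintegral_congr fun t => ?_))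
  simp [enorm_eq_nnnorm, mul_pow, mul_comm]

/-- `⟨x, f²(A)x⟩ = ‖f(A)x‖²`. -/
lemma inner_borelApply_sq {A : H →L[ℂ] H} (hA : IsSelfAdjoint A) {f : ℝ≥0 → ℝ} {x : H}
    (hf : MemLp f 2 (spectralMeasure A x))
    (hf2 : MemLp (fun t => f t ^ 2) 2 (spectralMeasure A x)) :
    ⟪x, borelApply A (fun t => f t ^ 2) x⟫_ℂ = ⟪borelApply A f x, borelApply A f x⟫_ℂ := by
  -- With `φ(A) = 1`, both sides are `∫ φ f²`.
  obtain ⟨φ, hφ⟩ := exists_contCalc_eq_one hA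
  have h1 := inner_contCalc_borelApply hf2 φ
  have h2 := inner_borelApply_contCalc_borelApply hf φ
  rw [hφ, one_apply_eq_self] at h1 h2
  rw [h1, h2]

lemma mem_opMul_borelCalc_iff {A : H →L[ℂ] H} {f g : ℝ≥0 → ℝ} {x : H} (hfm : Measurable f)
    (hgm : Measurable g) (hg : MemLp g 2 (spectralMeasure A x)) :
    x ∈ (opMul (borelCalc A f) (borelCalc A g)).domain ↔
      MemLp (fun t => f t * g t) 2 (spectralMeasure A x) := by
  rw [← memLp_borelApply_iff hfm hgm hg]
  constructor
  · rintro ⟨y, hy, rfl⟩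
    exact hy
  · intro h
    exact ⟨⟨x, hg⟩, h, rfl⟩

/-! ### The Čebyšev functional -/

/-- For `x` in the domains of `f(A)` and `f(A)g(A)`, the product term of the Čebyšev
functional is `⟨f(A)x, g(A)x⟩`. -/
lemma inner_opMul_borelCalc {A : H →L[ℂ] H} {f g : ℝ≥0 → ℝ} {x : H}
    (hf : x ∈ (borelCalc A f).domain)
    (hfg : x ∈ (opMul (borelCalc A f) (borelCalc A g)).domain) :
    ⟪x, opMul (borelCalc A f) (borelCalc A g) ⟨x, hfg⟩⟫_ℂ
      = ⟪borelApply A f x, borelApply A g x⟫_ℂ := by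
  have h : MemLp f 2 (spectralMeasure A (borelApply A g x)) := by
    obtain ⟨y, hy, rfl⟩ := hfg
    exact hy
  exact (inner_borelApply_comm hf h).symm

/-- The Čebyšev functional is the inner product of the components of `f(A)x` and `g(A)x`
orthogonal to the unit vector `x`. -/
lemma cebysev_eq_inner {A : H →L[ℂ] H} {f g : ℝ≥0 → ℝ} {x : H} (hx : ‖x‖ = 1)
    (hf : x ∈ (borelCalc A f).domain) (hg : x ∈ (borelCalc A g).domain)
    (hfg : x ∈ (opMul (borelCalc A f) (borelCalc A g)).domain) :
    cebysev A f g x hf hg hfg =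
      ⟪borelApply A f x - ⟪x, borelApply A f x⟫_ℂ • x,
        borelApply A g x - ⟪x, borelApply A g x⟫_ℂ • x⟫_ℂ := by
  have hxx : ⟪x, x⟫_ℂ = 1 := by simp [inner_self_eq_norm_sq_to_K, hx]
  have hfx : ⟪borelApply A f x, x⟫_ℂ = ⟪x, borelApply A f x⟫_ℂ := inner_borelApply_comm hf hf
  rw [cebysev, inner_opMul_borelCalc hf hfg]
  change _ - ⟪x, borelApply A f x⟫_ℂ * ⟪x, borelApply A g x⟫_ℂ = _
  simp only [inner_sub_left, inner_sub_right, inner_smul_left, inner_smul_right, hxx, hfx,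
    inner_conj_symm]
  ring

open scoped ComplexOrder in
lemma cebysev_self_nonneg {A : H →L[ℂ] H} {f : ℝ≥0 → ℝ} {x : H} (hx : ‖x‖ = 1)
    (hf : x ∈ (borelCalc A f).domain)
    (hff : x ∈ (opMul (borelCalc A f) (borelCalc A f)).domain) :
    0 ≤ cebysev A f f x hf hf hff := by
  rw [cebysev_eq_inner hx, inner_self_eq_norm_sq_to_K, ← RCLike.ofReal_pow]
  exact Complex.zero_le_real.2 (sq_nonneg _)

lemma sqrt_re_cebysev_self {A : H →L[ℂ] H} {f : ℝ≥0 → ℝ} {x : H} (hx : ‖x‖ = 1)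
    (hf : x ∈ (borelCalc A f).domain)
    (hff : x ∈ (opMul (borelCalc A f) (borelCalc A f)).domain) :
    √(cebysev A f f x hf hf hff).re = ‖borelApply A f x - ⟪x, borelApply A f x⟫_ℂ • x‖ := by
  rw [cebysev_eq_inner hx, inner_self_eq_norm_sq_to_K, ← RCLike.ofReal_pow]
  exact Real.sqrt_sq (norm_nonneg _)

lemma cebysev_self_eq {A : H →L[ℂ] H} (hA : IsSelfAdjoint A) {f : ℝ≥0 → ℝ} {x : H}
    (hf : x ∈ (borelCalc A f).domain)
    (hff : x ∈ (opMul (borelCalc A f) (borelCalc A f)).domain)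
    (hf2 : x ∈ (borelCalc A (fun t => f t ^ 2)).domain) :
    cebysev A f f x hf hf hff =
      ⟪x, borelCalc A (fun t => f t ^ 2) ⟨x, hf2⟩⟫_ℂ - ⟪x, borelCalc A f ⟨x, hf⟩⟫_ℂ ^ 2 := by
  rw [cebysev, inner_opMul_borelCalc hf hff, ← inner_borelApply_sq hA hf hf2, sq]
  rfl

end PreGruss

open scoped ComplexOrder in
theorem theorem2p1 {H : Type*} [NormedAddCommGroup H] [InnerProductSpace ℂ H] [CompleteSpace H]
    (A : H →L[ℂ] H) (hA : A.IsPositive)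
    (f g : ℝ≥0 → ℝ) (hf : Measurable f) (hg : Measurable g)
    (x : H) (hx : ‖x‖ = 1)
    (hxf : x ∈ (PreGruss.borelCalc A f).domain) (hxg : x ∈ (PreGruss.borelCalc A g).domain)
    (hxff : x ∈ (PreGruss.opMul (PreGruss.borelCalc A f) (PreGruss.borelCalc A f)).domain)
    (hxgg : x ∈ (PreGruss.opMul (PreGruss.borelCalc A g) (PreGruss.borelCalc A g)).domain) :
    ∃ (hxfg : x ∈ (PreGruss.opMul (PreGruss.borelCalc A f) (PreGruss.borelCalc A g)).domain)
      (hxf2 : x ∈ (PreGruss.borelCalc A (fun t => f t ^ 2)).domain)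
      (hxg2 : x ∈ (PreGruss.borelCalc A (fun t => g t ^ 2)).domain),
      0 ≤ PreGruss.cebysev A f f x hxf hxf hxff ∧
      0 ≤ PreGruss.cebysev A g g x hxg hxg hxgg ∧
      ‖PreGruss.cebysev A f g x hxf hxg hxfg‖ ≤
        √(PreGruss.cebysev A f f x hxf hxf hxff).re *
          √(PreGruss.cebysev A g g x hxg hxg hxgg).re ∧
      PreGruss.cebysev A f f x hxf hxf hxff =
        ⟪x, PreGruss.borelCalc A (fun t => f t ^ 2) ⟨x, hxf2⟩⟫_ℂ -
          ⟪x, PreGruss.borelCalc A f ⟨x, hxf⟩⟫_ℂ ^ 2 ∧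
      PreGruss.cebysev A g g x hxg hxg hxgg =
        ⟪x, PreGruss.borelCalc A (fun t => g t ^ 2) ⟨x, hxg2⟩⟫_ℂ -
          ⟪x, PreGruss.borelCalc A g ⟨x, hxg⟩⟫_ℂ ^ 2 := by
  have hf2 := (PreGruss.mem_opMul_borelCalc_iff hf hf hxf).1 hxff
  have hg2 := (PreGruss.mem_opMul_borelCalc_iff hg hg hxg).1 hxgg
  have hfg : MemLp (fun t => f t * g t) 2 (PreGruss.spectralMeasure A x) := by
    refine (hf2.add hg2).mono (hf.mul hg).aestronglyMeasurable (Eventually.of_forall fun t => ?_)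
    simp only [Pi.add_apply, Real.norm_eq_abs]
    rw [abs_of_nonneg (add_nonneg (mul_self_nonneg (f t)) (mul_self_nonneg (g t))), abs_le]
    constructor <;>
      nlinarith [sq_nonneg (f t + g t), sq_nonneg (f t - g t), sq_nonneg (f t), sq_nonneg (g t)]
  have hxfg := (PreGruss.mem_opMul_borelCalc_iff hf hg hxg).2 hfg
  have hxf2 : x ∈ (PreGruss.borelCalc A (fun t => f t ^ 2)).domain := by
    simp only [sq]; exact hf2
  have hxg2 : x ∈ (PreGruss.borelCalc A (fun t => g t ^ 2)).domain := by
    simp only [sq]; exact hg2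
  refine ⟨hxfg, hxf2, hxg2, PreGruss.cebysev_self_nonneg hx hxf hxff,
    PreGruss.cebysev_self_nonneg hx hxg hxgg, ?_,
    PreGruss.cebysev_self_eq hA.isSelfAdjoint hxf hxff hxf2,
    PreGruss.cebysev_self_eq hA.isSelfAdjoint hxg hxgg hxg2⟩
  rw [PreGruss.cebysev_eq_inner hx, PreGruss.sqrt_re_cebysev_self hx hxf hxff,
    PreGruss.sqrt_re_cebysev_self hx hxg hxgg]
  exact norm_inner_le_norm _ _
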